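/- Let $b,c\in\mathbb{Z}$ be such that $F(x)=x^4+bx+c\in\mathbb{Z}[x]$ is irreducible, and let $K=\mathbb{Q}(\alpha)$ with $F(\alpha)=0$. Let $\mathcal{O}_K$ be the ring of integers of $K$. For $\theta\in\mathcal{O}_K$ with $K=\mathbb{Q}(\theta)$ let $\mathrm{ind}(\theta)=[\mathcal{O}_K:\mathbb{Z}[\theta]]$, let $i(K)=\gcd\{\mathrm{ind}(\theta):\theta\in\mathcal{O}_K,\ K=\mathbb{Q}(\theta)\}$ be the index of $K$, and let $\nu_2$ denote the $2$-adic valuation. Suppose that one of the following conditions holds: (1) $b\equiv 0\pmod{16}$ and $c\equiv -1\pmod{16}$; (2) $b\equiv 8\pmod{16}$ and $c\equiv 7\pmod{16}$. Then $\nu_2(i(K))=1$, and $K$ is not monogenic, i.e. there is no $\theta\in\mathcal{O}_K$ with $\mathcal{O}_K=\mathbb{Z}[\theta]$. -/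

import Mathlib

open Polynomial NumberField

/-- The index `[𝓞 K : ℤ[θ]]` of the additive group of `ℤ[θ]` in that of `𝓞 K`
(it is `0` when this index is infinite, that is, when `θ` does not generate `K` over `ℚ`). -/
noncomputable def elementIndex {K : Type*} [Field K] (θ : 𝓞 K) : ℕ :=
  (Subalgebra.toSubmodule (Algebra.adjoin ℤ {θ})).toAddSubgroup.index

/-- The index `i(K)`: the greatest natural number that divides `[𝓞 K : ℤ[θ]]` for every `θ ∈ 𝓞 K`
with `K = ℚ(θ)`. For a number field the set of these common divisors is bounded, since there is an
integral primitive element and its index is finite and nonzero. -/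
noncomputable def fieldIndex (K : Type*) [Field K] [NumberField K] : ℕ :=
  sSup {d : ℕ | ∀ θ : 𝓞 K, IntermediateField.adjoin ℚ {(θ : K)} = ⊤ → d ∣ elementIndex θ}

/-- `K` is monogenic: `𝓞 K = ℤ[θ]` for some `θ`. -/
def IsMonogenicField (K : Type*) [Field K] [NumberField K] : Prop :=
  ∃ θ : 𝓞 K, Algebra.adjoin ℤ {θ} = ⊤

/-! With y = α - 1 the equation becomes y⁴ + 4y³ + 6y² + 4ky + 16d = 0, and the congruences say that
k is an odd integer and d an integer. The 2-adic Newton polygon then has three sides, so 2 has three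
primes above it, all with residue field F₂. Of the three homomorphisms 𝓞 K → F₂, two agree at any
given θ, hence on ℤ[θ], which therefore has even (or infinite) index. These homomorphisms are
explicit on `QuarticOrder`; `exists_toField_eq_of_two_mul` shows this order to be maximal at 2, so
they extend to 𝓞 K. Conversely γ = y²/2 generates K, and its index is finite and not divisible by 4
(`elementIndex_halfSq`). So the valuation is exactly 1. -/

theorem index_ne_zero_and_not_four_dvd {G : Type*} [AddCommGroup G] [Module.Finite ℤ G]
    (H : AddSubgroup G) {m : ℤ} (hm : Odd m) {t : G} (ht : (2 : ℤ) • t ∈ H)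
    (h : ∀ x, ∃ j : ℤ, m • x - j • t ∈ H) : H.index ≠ 0 ∧ ¬ 4 ∣ H.index := by
  have hm0 : m ≠ 0 := by rintro rfl; simp at hm
  have hq (x : G ⧸ H) : ∃ j : ℤ, m • x = j • (t : G ⧸ H) := by
    induction x using QuotientAddGroup.induction_on with
    | H x =>
      obtain ⟨j, hj⟩ := h x
      refine ⟨j, ?_⟩
      rw [← sub_eq_zero]
      exact (QuotientAddGroup.eq_zero_iff _).2 hj
  have ht' : (2 : ℤ) • (t : G ⧸ H) = 0 := (QuotientAddGroup.eq_zero_iff _).2 ht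
  have hfg : AddGroup.FG (G ⧸ H) := by
    have : AddGroup.FG G := Module.Finite.iff_addGroup_fg.1 inferInstance
    exact QuotientAddGroup.fg H
  have hfin : Finite (G ⧸ H) := by
    apply AddCommGroup.finite_of_fg_isAddTorsion
    intro x
    obtain ⟨j, hj⟩ := hq x
    rw [isOfFinAddOrder_iff_zsmul_eq_zero]
    refine ⟨2 * m, by positivity, ?_⟩
    rw [mul_smul, hj, smul_comm, ht', smul_zero]
  refine ⟨(AddSubgroup.index_ne_zero_iff_finite).2 hfin, fun h4 => ?_⟩
  -- Multiplication by the odd m has kernel of odd order and image inside {0, t}, so the 2-part of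
  -- the index is at most 2.
  set f : (G ⧸ H) →+ (G ⧸ H) := zsmulAddGroupHom m with hf
  have hfx (x) : f x = m • x := rfl
  have hodd : ¬ 2 ∣ Nat.card f.ker := by
    intro h2
    obtain ⟨⟨x, hx⟩, hx2⟩ := exists_prime_addOrderOf_dvd_card' 2 h2
    rw [AddMonoidHom.mem_ker, hfx] at hx
    have h1 : ((2 : ℕ) : ℤ) ∣ m := by
      rw [← hx2, addOrderOf_dvd_iff_zsmul_eq_zero]
      exact Subtype.ext hx
    exact (Int.not_even_iff_odd.2 hm) (even_iff_two_dvd.2 (by exact_mod_cast h1))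
  have hcard : Nat.card f.range ≤ 2 := by
    have hsub : (f.range : Set (G ⧸ H)) ⊆ {0, (t : G ⧸ H)} := by
      rintro _ ⟨x, rfl⟩
      obtain ⟨j, hj⟩ := hq x
      rw [hfx, hj]
      rcases Int.even_or_odd' j with ⟨i, rfl | rfl⟩
      · left; rw [mul_comm, mul_smul, ht', smul_zero]
      · right
        rw [add_smul, mul_comm, mul_smul, ht', smul_zero, zero_add, one_smul]
        rfl
    calc Nat.card f.range = (f.range : Set (G ⧸ H)).ncard := rfl
      _ ≤ ({0, (t : G ⧸ H)} : Set (G ⧸ H)).ncard := Set.ncard_le_ncard hsub (Set.toFinite _)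
      _ ≤ 2 := (Set.ncard_insert_le _ _).trans (by simp)
  have hprod : Nat.card f.ker * Nat.card f.range = H.index := by
    rw [← AddSubgroup.index_ker, AddSubgroup.card_mul_index]; rfl
  have hdvd : 4 ∣ Nat.card f.range := by
    rw [← hprod] at h4
    refine Nat.Coprime.dvd_of_dvd_mul_left ?_ h4
    exact Nat.Coprime.pow_left 2 ((Nat.Prime.coprime_iff_not_dvd Nat.prime_two).2 hodd)
  have := Nat.le_of_dvd Nat.card_pos hdvd
  omega

/-! ### Homomorphisms to F₂ -/

/-- If a ring `R` has three distinct homomorphisms to `ZMod 2`, then no subring `ℤ[θ]` has odd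
index in it. -/
theorem two_dvd_index_adjoin_of_three_homs {R : Type*} [CommRing R] {φ : Fin 3 → (R →+* ZMod 2)}
    (hφ : Function.Injective φ) (θ : R) :
    2 ∣ (Subalgebra.toSubmodule (Algebra.adjoin ℤ {θ})).toAddSubgroup.index := by
  set H := (Subalgebra.toSubmodule (Algebra.adjoin ℤ {θ})).toAddSubgroup with hH
  by_contra h
  have hcast : ((H.index : ℕ) : ZMod 2) = 1 :=
    ZMod.natCast_eq_one_iff_odd.2 (Nat.not_even_iff_odd.1 fun h' => h (even_iff_two_dvd.1 h'))
  obtain ⟨i, j, hij, hθ⟩ := Fintype.exists_ne_map_eq_of_card_lt (fun i => φ i θ)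
    (by simp [ZMod.card])
  refine hij (hφ (RingHom.ext fun x => ?_))
  have hx : H.index • x ∈ Algebra.adjoin ℤ {θ} := H.nsmul_index_mem x
  rw [Algebra.adjoin_singleton_eq_range_aeval] at hx
  obtain ⟨p, hp⟩ := hx
  have key (l : Fin 3) : φ l x = eval₂ (Int.castRingHom (ZMod 2)) (φ l θ) p := by
    have h1 : φ l (H.index • x) = φ l x := by rw [nsmul_eq_mul, map_mul, map_natCast, hcast, one_mul]
    rw [← h1, ← hp]
    change φ l (aeval θ p) = _
    rw [aeval_def, hom_eval₂]
    congr 1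
    exact RingHom.ext_int _ _
  rw [key, key]
  congr 1

/-- An element divisible by two in an integral overring is in the kernel of every
homomorphism to `ZMod 2`. -/
theorem map_eq_zero_of_two_mul_isIntegral {A B : Type*} [CommRing A] [CommRing B] {f : A →+* B}
    (hf : Function.Injective f) (φ : A →+* ZMod 2) {a : A} {w : B} (hw : IsIntegral ℤ w)
    (h : f a = 2 * w) : φ a = 0 := by
  obtain ⟨p, hp, hpw⟩ := hw
  -- Scaling the roots of a monic equation of w by 2 gives an equation of 2w that reduces to Xⁿ
  -- modulo 2.
  have h0 : aeval (algebraMap ℤ B 2 * w) (scaleRoots p 2) = 0 := scaleRoots_aeval_eq_zero hpw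
  have h1 : eval₂ (Int.castRingHom A) a (scaleRoots p 2) = 0 := by
    apply hf
    rw [hom_eval₂, h, map_zero, ← h0, aeval_def]
    congr 1
    · exact RingHom.ext_int _ _
    · simp
  have h2 := congrArg φ h1
  rw [hom_eval₂, map_zero, RingHom.ext_int (φ.comp (Int.castRingHom A)) (Int.castRingHom (ZMod 2)),
    ← eval_map, map_scaleRoots _ _ _ (by simp [hp.leadingCoeff])] at h2
  have h3 : (Int.castRingHom (ZMod 2)) 2 = 0 := by decide
  rw [h3, scaleRoots_zero, (hp.map _).leadingCoeff, one_smul, eval_pow, eval_X] at h2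
  exact eq_zero_of_pow_eq_zero h2

/-- A homomorphism to `ZMod 2` extends along an inclusion of odd exponent. -/
theorem exists_extension_zmod_two {A B : Type*} [CommRing A] [CommRing B] {f : A →+* B}
    (hf : Function.Injective f) {m : ℤ} (hm : Odd m) (h : ∀ x : B, ∃ a, f a = m * x)
    (φ : A →+* ZMod 2) : ∃ ψ : B →+* ZMod 2, ∀ a, ψ (f a) = φ a := by
  -- The extension is x ↦ φ(mx), since m maps to 1.
  choose g hg using h
  have hm1 : (m : ZMod 2) = 1 := ZMod.intCast_eq_one_iff_odd.2 hm
  have hmul (x y : B) : φ (g (x * y)) = φ (g x) * φ (g y) := by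
    have : g x * g y = m * g (x * y) := hf (by simp only [map_mul, hg, map_intCast]; ring)
    rw [← map_mul, this, map_mul, map_intCast, hm1, one_mul]
  have hadd (x y : B) : φ (g (x + y)) = φ (g x) + φ (g y) := by
    have : g x + g y = g (x + y) := hf (by simp only [map_add, hg]; ring)
    rw [← map_add, this]
  have hf' (a : A) : φ (g (f a)) = φ a := by
    have : g (f a) = m * a := hf (by simp only [map_mul, hg, map_intCast])
    rw [this, map_mul, map_intCast, hm1, one_mul]
  refine ⟨RingHom.mk' ⟨⟨fun x => φ (g x), ?_⟩, hmul⟩ hadd, hf'⟩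
  have := hf' 1
  rwa [map_one, map_one] at this

/-! ### The explicit order and its residue maps -/

/-- The ring with `ℤ`-basis `1, y, y² / 2, (y³ + 2y) / 4`, where
`y⁴ + 4y³ + 6y² + 4ky + 16d = 0`. -/
@[ext]
structure QuarticOrder (k d : ℤ) where
  c0 : ℤ
  c1 : ℤ
  c2 : ℤ
  c3 : ℤ

namespace QuarticOrder

variable {k d : ℤ}

instance : Zero (QuarticOrder k d) := ⟨⟨0, 0, 0, 0⟩⟩
instance : One (QuarticOrder k d) := ⟨⟨1, 0, 0, 0⟩⟩
instance : Add (QuarticOrder k d) :=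
  ⟨fun a b => ⟨a.c0 + b.c0, a.c1 + b.c1, a.c2 + b.c2, a.c3 + b.c3⟩⟩
instance : Neg (QuarticOrder k d) := ⟨fun a => ⟨-a.c0, -a.c1, -a.c2, -a.c3⟩⟩
instance : Mul (QuarticOrder k d) :=
  ⟨fun a b =>
    ⟨a.c0 * b.c0 - 4 * d * (a.c1 * b.c3 + a.c3 * b.c1) - 4 * d * (a.c2 * b.c2)
        + 8 * d * (a.c2 * b.c3 + a.c3 * b.c2) - 14 * d * (a.c3 * b.c3),
      a.c0 * b.c1 + a.c1 * b.c0 - (a.c1 * b.c2 + a.c2 * b.c1)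
        + (2 - k) * (a.c1 * b.c3 + a.c3 * b.c1) + (2 - k) * (a.c2 * b.c2)
        + (2 * k - 3 - 2 * d) * (a.c2 * b.c3 + a.c3 * b.c2)
        + (4 * d + 4 - 3 * k) * (a.c3 * b.c3),
      a.c0 * b.c2 + a.c2 * b.c0 + 2 * (a.c1 * b.c1) - 2 * (a.c1 * b.c3 + a.c3 * b.c1)
        - 3 * (a.c2 * b.c2) + (6 - k) * (a.c2 * b.c3 + a.c3 * b.c2)
        + (2 * k - 10 - 2 * d) * (a.c3 * b.c3),
      a.c0 * b.c3 + a.c3 * b.c0 + 2 * (a.c1 * b.c2 + a.c2 * b.c1)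
        - 4 * (a.c1 * b.c3 + a.c3 * b.c1) - 4 * (a.c2 * b.c2)
        + 6 * (a.c2 * b.c3 + a.c3 * b.c2) + (-8 - k) * (a.c3 * b.c3)⟩⟩

@[simp] theorem zero_c0 : (0 : QuarticOrder k d).c0 = 0 := rfl
@[simp] theorem zero_c1 : (0 : QuarticOrder k d).c1 = 0 := rfl
@[simp] theorem zero_c2 : (0 : QuarticOrder k d).c2 = 0 := rfl
@[simp] theorem zero_c3 : (0 : QuarticOrder k d).c3 = 0 := rfl
@[simp] theorem one_c0 : (1 : QuarticOrder k d).c0 = 1 := rfl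
@[simp] theorem one_c1 : (1 : QuarticOrder k d).c1 = 0 := rfl
@[simp] theorem one_c2 : (1 : QuarticOrder k d).c2 = 0 := rfl
@[simp] theorem one_c3 : (1 : QuarticOrder k d).c3 = 0 := rfl

section

variable (a b : QuarticOrder k d)

@[simp] theorem add_c0 : (a + b).c0 = a.c0 + b.c0 := rfl
@[simp] theorem add_c1 : (a + b).c1 = a.c1 + b.c1 := rfl
@[simp] theorem add_c2 : (a + b).c2 = a.c2 + b.c2 := rfl
@[simp] theorem add_c3 : (a + b).c3 = a.c3 + b.c3 := rfl
@[simp] theorem neg_c0 : (-a).c0 = -a.c0 := rfl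
@[simp] theorem neg_c1 : (-a).c1 = -a.c1 := rfl
@[simp] theorem neg_c2 : (-a).c2 = -a.c2 := rfl
@[simp] theorem neg_c3 : (-a).c3 = -a.c3 := rfl

theorem mul_c0 : (a * b).c0 =
    a.c0 * b.c0 - 4 * d * (a.c1 * b.c3 + a.c3 * b.c1) - 4 * d * (a.c2 * b.c2)
      + 8 * d * (a.c2 * b.c3 + a.c3 * b.c2) - 14 * d * (a.c3 * b.c3) := rfl

theorem mul_c1 : (a * b).c1 =
    a.c0 * b.c1 + a.c1 * b.c0 - (a.c1 * b.c2 + a.c2 * b.c1)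
      + (2 - k) * (a.c1 * b.c3 + a.c3 * b.c1) + (2 - k) * (a.c2 * b.c2)
      + (2 * k - 3 - 2 * d) * (a.c2 * b.c3 + a.c3 * b.c2)
      + (4 * d + 4 - 3 * k) * (a.c3 * b.c3) := rfl

theorem mul_c2 : (a * b).c2 =
    a.c0 * b.c2 + a.c2 * b.c0 + 2 * (a.c1 * b.c1) - 2 * (a.c1 * b.c3 + a.c3 * b.c1)
      - 3 * (a.c2 * b.c2) + (6 - k) * (a.c2 * b.c3 + a.c3 * b.c2)
      + (2 * k - 10 - 2 * d) * (a.c3 * b.c3) := rfl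

theorem mul_c3 : (a * b).c3 =
    a.c0 * b.c3 + a.c3 * b.c0 + 2 * (a.c1 * b.c2 + a.c2 * b.c1)
      - 4 * (a.c1 * b.c3 + a.c3 * b.c1) - 4 * (a.c2 * b.c2)
      + 6 * (a.c2 * b.c3 + a.c3 * b.c2) + (-8 - k) * (a.c3 * b.c3) := rfl

end

instance : CommRing (QuarticOrder k d) where
  add_assoc a b c := by ext <;> simp [add_assoc]
  zero_add a := by ext <;> simp
  add_zero a := by ext <;> simp
  add_comm a b := by ext <;> simp [add_comm]
  neg_add_cancel a := by ext <;> simp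
  mul_assoc a b c := by ext <;> simp only [mul_c0, mul_c1, mul_c2, mul_c3] <;> ring
  one_mul a := by ext <;> simp [mul_c0, mul_c1, mul_c2, mul_c3]
  mul_one a := by ext <;> simp [mul_c0, mul_c1, mul_c2, mul_c3]
  zero_mul a := by ext <;> simp [mul_c0, mul_c1, mul_c2, mul_c3]
  mul_zero a := by ext <;> simp [mul_c0, mul_c1, mul_c2, mul_c3]
  left_distrib a b c := by
    ext <;> simp only [mul_c0, mul_c1, mul_c2, mul_c3, add_c0, add_c1, add_c2, add_c3] <;> ring
  right_distrib a b c := by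
    ext <;> simp only [mul_c0, mul_c1, mul_c2, mul_c3, add_c0, add_c1, add_c2, add_c3] <;> ring
  mul_comm a b := by ext <;> simp only [mul_c0, mul_c1, mul_c2, mul_c3] <;> ring
  nsmul := nsmulRec
  zsmul := zsmulRec

instance : Module.Finite ℤ (QuarticOrder k d) := by
  let f : (Fin 4 → ℤ) →+ QuarticOrder k d :=
    AddMonoidHom.mk' (fun v => ⟨v 0, v 1, v 2, v 3⟩) fun v w => rfl
  refine Module.Finite.of_surjective f.toIntLinearMap fun a => ⟨![a.c0, a.c1, a.c2, a.c3], ?_⟩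
  rfl

/-- Reduction to `ZMod 2` with `y ↦ 0`, `y² / 2 ↦ g`, `(y³ + 2y) / 4 ↦ h`. -/
def residueHom (hk : Odd k) (g h : ZMod 2) (hgh : g * h = g) : QuarticOrder k d →+* ZMod 2 :=
  RingHom.mk' ⟨⟨fun a => a.c0 + a.c2 * g + a.c3 * h, by simp⟩, fun a b => by
    -- For γ = y²/2 and β = (y³ + 2y)/4, setting y to 0 and k to 1 modulo 2 reduces the table to γ²
    -- = γ, γβ = γ, β² = β; hence the condition `hgh`.
    have hk : (k : ZMod 2) = 1 := ZMod.intCast_eq_one_iff_odd.2 hk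
    have hg : g * g = g := by clear hgh; revert g; decide
    have hh : h * h = h := by clear hgh; revert h; decide
    have h2 : (2 : ZMod 2) = 0 := by decide
    simp only [mul_c0, mul_c2, mul_c3]
    push_cast
    rw [hk]
    linear_combination
      (-2 * d * (a.c1 * b.c3 + a.c3 * b.c1) - 2 * d * (a.c2 * b.c2)
        + 4 * d * (a.c2 * b.c3 + a.c3 * b.c2) - 7 * d * (a.c3 * b.c3)
        + (a.c1 * b.c1 - (a.c1 * b.c3 + a.c3 * b.c1) - 2 * (a.c2 * b.c2)
          + 2 * (a.c2 * b.c3 + a.c3 * b.c2) - (4 + d) * (a.c3 * b.c3)) * g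
        + ((a.c1 * b.c2 + a.c2 * b.c1) - 2 * (a.c1 * b.c3 + a.c3 * b.c1) - 2 * (a.c2 * b.c2)
          + 3 * (a.c2 * b.c3 + a.c3 * b.c2) - 5 * (a.c3 * b.c3)) * h) * h2
      - a.c2 * b.c2 * hg - (a.c2 * b.c3 + a.c3 * b.c2) * hgh - a.c3 * b.c3 * hh⟩ fun a b => by simp; ring

end QuarticOrder

namespace QuarticOrder

variable {k d : ℤ}

@[simp] theorem residueHom_apply (hk : Odd k) (g h : ZMod 2) (hgh : g * h = g)
    (a : QuarticOrder k d) : residueHom hk g h hgh a = a.c0 + a.c2 * g + a.c3 * h := rfl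

/-- The three homomorphisms to `ZMod 2`. -/
def residueHoms (hk : Odd k) : Fin 3 → (QuarticOrder k d →+* ZMod 2) :=
  ![residueHom hk 0 0 (by simp), residueHom hk 0 1 (by simp), residueHom hk 1 1 (by simp)]

theorem residueHoms_injective (hk : Odd k) :
    Function.Injective (residueHoms (d := d) hk) := by
  intro i j hij
  have h2 := DFunLike.congr_fun hij ⟨0, 0, 1, 0⟩
  have h3 := DFunLike.congr_fun hij ⟨0, 0, 0, 1⟩
  fin_cases i <;> fin_cases j <;> simp [residueHoms] at h2 h3 ⊢

/-! ### Embedding in K and maximality at 2 -/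

variable {K : Type*} [Field K] [CharZero K]

/-- The homomorphism to a field given by a root `y` of `x⁴ + 4x³ + 6x² + 4kx + 16d`. -/
def toField (y : K) (hy : y ^ 4 + 4 * y ^ 3 + 6 * y ^ 2 + 4 * k * y + 16 * d = 0) :
    QuarticOrder k d →+* K :=
  RingHom.mk' ⟨⟨fun a => a.c0 + a.c1 * y + a.c2 * (y ^ 2 / 2) + a.c3 * ((y ^ 3 + 2 * y) / 4),
      by simp⟩, fun a b => by
    have h13 : y * ((y ^ 3 + 2 * y) / 4) =
        -4 * d + (2 - k) * y - 2 * (y ^ 2 / 2) - 4 * ((y ^ 3 + 2 * y) / 4) := by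
      linear_combination hy / 4
    have h22 : (y ^ 2 / 2) * (y ^ 2 / 2) =
        -4 * d + (2 - k) * y - 3 * (y ^ 2 / 2) - 4 * ((y ^ 3 + 2 * y) / 4) := by
      linear_combination hy / 4
    have h23 : (y ^ 2 / 2) * ((y ^ 3 + 2 * y) / 4) =
        8 * d + (2 * k - 3 - 2 * d) * y + (6 - k) * (y ^ 2 / 2) + 6 * ((y ^ 3 + 2 * y) / 4) := by
      linear_combination (y / 8 - 1 / 2) * hy
    have h33 : ((y ^ 3 + 2 * y) / 4) * ((y ^ 3 + 2 * y) / 4) =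
        -14 * d + (4 * d + 4 - 3 * k) * y + (2 * k - 10 - 2 * d) * (y ^ 2 / 2)
          + (-8 - k) * ((y ^ 3 + 2 * y) / 4) := by
      linear_combination (y ^ 2 / 16 - y / 4 + 7 / 8) * hy
    simp only [mul_c0, mul_c1, mul_c2, mul_c3]
    push_cast
    linear_combination -(a.c1 * b.c3 + a.c3 * b.c1) * h13 - a.c2 * b.c2 * h22
      - (a.c2 * b.c3 + a.c3 * b.c2) * h23 - a.c3 * b.c3 * h33⟩ fun a b => by
    simp only [MonoidHom.coe_mk, OneHom.coe_mk, add_c0, add_c1, add_c2, add_c3]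
    push_cast; ring

theorem toField_apply (y : K) (hy : y ^ 4 + 4 * y ^ 3 + 6 * y ^ 2 + 4 * k * y + 16 * d = 0)
    (a : QuarticOrder k d) : toField y hy a =
      a.c0 + a.c1 * y + a.c2 * (y ^ 2 / 2) + a.c3 * ((y ^ 3 + 2 * y) / 4) := rfl

theorem isIntegral_toField (y : K) (hy : y ^ 4 + 4 * y ^ 3 + 6 * y ^ 2 + 4 * k * y + 16 * d = 0)
    (a : QuarticOrder k d) : IsIntegral ℤ (toField y hy a) :=
  map_isIntegral_int _ (Algebra.IsIntegral.isIntegral a)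

/-- An element of the order that is twice an integral element is twice an element of the order. -/
theorem exists_toField_eq_of_two_mul (hk : Odd k) (y : K)
    (hy : y ^ 4 + 4 * y ^ 3 + 6 * y ^ 2 + 4 * k * y + 16 * d = 0)
    (hinj : Function.Injective (toField y hy)) {a : QuarticOrder k d} {w : K}
    (hw : IsIntegral ℤ w) (h : toField y hy a = 2 * w) : ∃ a', toField y hy a' = w := by
  have key (g e : ZMod 2) (hge : g * e = g) : (a.c0 + a.c2 * g + a.c3 * e : ZMod 2) = 0 :=
    map_eq_zero_of_two_mul_isIntegral hinj (residueHom hk g e hge) hw h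
  have h0 := key 0 0 (by simp)
  have h1 := key 0 1 (by simp)
  have h2 := key 1 1 (by simp)
  simp only [mul_zero, mul_one, add_zero] at h0 h1 h2
  rw [h0, zero_add] at h1
  rw [h0, h1, zero_add, add_zero] at h2
  rw [ZMod.intCast_eq_zero_iff_even] at h0 h1 h2
  obtain ⟨a0, h0⟩ := h0
  obtain ⟨a3, h1⟩ := h1
  obtain ⟨a2, h2⟩ := h2
  obtain ⟨a1, ha1 | ha1⟩ := Int.even_or_odd' a.c1
  · refine ⟨⟨a0, a1, a2, a3⟩, mul_left_cancel₀ (two_ne_zero (α := K)) ?_⟩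
    rw [← h, toField_apply, toField_apply, h0, h1, h2, ha1]
    push_cast; ring
  -- An odd y-coordinate would make y/2 integral, so y²/2 = 2(y/2)² would be killed by every residue
  -- map, but one sends it to 1.
  · exfalso
    have hw' : y / 2 = w - toField y hy ⟨a0, a1, a2, a3⟩ := by
      refine mul_left_cancel₀ (two_ne_zero (α := K)) ?_
      rw [mul_sub, ← h, toField_apply, toField_apply, h0, h1, h2, ha1]
      push_cast; ring
    have hy2 : IsIntegral ℤ (y / 2) := hw' ▸ hw.sub (isIntegral_toField y hy _)
    have := map_eq_zero_of_two_mul_isIntegral hinj (residueHom hk 1 1 (by simp))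
      (a := ⟨0, 0, 1, 0⟩) (hy2.pow 2) (by rw [toField_apply]; push_cast; ring)
    simp at this

theorem exists_toField_eq_of_two_pow_mul (hk : Odd k) (y : K)
    (hy : y ^ 4 + 4 * y ^ 3 + 6 * y ^ 2 + 4 * k * y + 16 * d = 0)
    (hinj : Function.Injective (toField y hy)) (n : ℕ) {a : QuarticOrder k d} {w : K}
    (hw : IsIntegral ℤ w) (h : toField y hy a = 2 ^ n * w) : ∃ a', toField y hy a' = w := by
  induction n generalizing a with
  | zero => exact ⟨a, by simpa using h⟩
  | succ n ih =>
    have hint : IsIntegral ℤ ((2 : K) ^ n * w) := by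
      have : IsIntegral ℤ (2 : K) := by
        simpa using isIntegral_algebraMap (R := ℤ) (A := K) (x := 2)
      exact (this.pow n).mul hw
    obtain ⟨a', ha'⟩ := exists_toField_eq_of_two_mul hk y hy hinj hint
      (by rw [h, pow_succ]; ring)
    exact ih ha'

end QuarticOrder

/-! ### The order inside K has odd exponent in 𝓞 K -/

section

variable {K : Type*} [Field K] {b c : ℤ} {α : K}

theorem monic_quartic (b c : ℤ) : (X ^ 4 + C b * X + C c : ℤ[X]).Monic := by monicity!

theorem natDegree_quartic (b c : ℤ) : (X ^ 4 + C b * X + C c : ℤ[X]).natDegree = 4 := by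
  compute_degree!

theorem isIntegral_of_quartic (hα : aeval α (X ^ 4 + C b * X + C c : ℤ[X]) = 0) :
    IsIntegral ℤ α := ⟨_, monic_quartic b c, hα⟩

variable [NumberField K]

theorem minpoly_eq_quartic (hF : Irreducible (X ^ 4 + C b * X + C c : ℤ[X]))
    (hα : aeval α (X ^ 4 + C b * X + C c : ℤ[X]) = 0) :
    minpoly ℤ α = X ^ 4 + C b * X + C c := by
  have hi := isIntegral_of_quartic hα
  refine eq_of_monic_of_associated (minpoly.monic hi) (monic_quartic b c) ?_
  exact (minpoly.prime_of_isIntegrallyClosed hi).irreducible.associated_of_dvd hF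
    (minpoly.isIntegrallyClosed_dvd hi hα)

theorem cubic_coeffs_eq_zero (hF : Irreducible (X ^ 4 + C b * X + C c : ℤ[X]))
    (hα : aeval α (X ^ 4 + C b * X + C c : ℤ[X]) = 0) {p : ℤ[X]} (hp : p.natDegree < 4)
    (h : aeval (α - 1) p = 0) : p = 0 := by
  have hi := isIntegral_of_quartic hα
  have h1 : aeval α (p.comp (X - C 1)) = 0 := by simpa [aeval_comp] using h
  have h2 := minpoly.isIntegrallyClosed_dvd hi h1
  rw [minpoly_eq_quartic hF hα] at h2
  have h3 : p.comp (X - C 1) = 0 := by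
    by_contra hne
    have := natDegree_le_of_dvd h2 hne
    rw [natDegree_quartic, natDegree_comp, natDegree_X_sub_C, mul_one] at this
    omega
  have h4 := congrArg (fun q => q.comp (X + C 1)) h3
  simpa [comp_assoc] using h4

theorem quartic_shift {k d : ℤ} (hα : aeval α (X ^ 4 + C b * X + C c : ℤ[X]) = 0)
    (hk : 4 + b = 4 * k) (hd : 1 + b + c = 16 * d) :
    (α - 1) ^ 4 + 4 * (α - 1) ^ 3 + 6 * (α - 1) ^ 2 + 4 * k * (α - 1) + 16 * d = 0 := by
  have h1 : α ^ 4 + b * α + c = 0 := by simpa using hα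
  have hk' : (4 + b : K) = 4 * k := by exact_mod_cast congrArg (Int.cast : ℤ → K) hk
  have hd' : (1 + b + c : K) = 16 * d := by exact_mod_cast congrArg (Int.cast : ℤ → K) hd
  linear_combination h1 - (α - 1) * hk' - hd'

theorem toField_injective {k d : ℤ} (hF : Irreducible (X ^ 4 + C b * X + C c : ℤ[X]))
    (hα : aeval α (X ^ 4 + C b * X + C c : ℤ[X]) = 0) (hy) :
    Function.Injective (QuarticOrder.toField (k := k) (d := d) (α - 1) hy) := by
  rw [injective_iff_map_eq_zero]
  intro a ha
  rw [QuarticOrder.toField_apply] at ha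
  -- Four times the image of a, as a polynomial in y.
  set p : ℤ[X] := C a.c3 * X ^ 3 + C (2 * a.c2) * X ^ 2 + C (4 * a.c1 + 2 * a.c3) * X
    + C (4 * a.c0) with hp
  have h0 : p = 0 := by
    refine cubic_coeffs_eq_zero hF hα ?_ ?_
    · exact lt_of_le_of_lt natDegree_cubic_le (by norm_num)
    · rw [hp]
      simp only [map_add, map_mul, map_pow, aeval_X, eq_intCast, map_intCast, map_ofNat]
      linear_combination 4 * ha
  have c0 := congrArg (fun q => coeff q 0) h0
  have c1 := congrArg (fun q => coeff q 1) h0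
  have c2 := congrArg (fun q => coeff q 2) h0
  have c3 := congrArg (fun q => coeff q 3) h0
  simp only [hp, coeff_zero] at c0 c1 c2 c3
  simp [coeff_X, coeff_C, -map_mul, -map_add, -eq_intCast] at c0 c1 c2 c3
  ext <;> simp <;> omega

/-- The discriminant N of 1, α, α², α³ carries 𝓞 K into ℤ[α], hence into the order. Maximality at 2
removes the power of 2 from N, leaving its odd part m. -/
theorem exists_odd_mul_mem_toField {k d : ℤ} (hk : Odd k)
    (hF : Irreducible (X ^ 4 + C b * X + C c : ℤ[X]))
    (hα : aeval α (X ^ 4 + C b * X + C c : ℤ[X]) = 0)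
    (hK : IntermediateField.adjoin ℚ {α} = ⊤) (hy) :
    ∃ m : ℤ, Odd m ∧ ∀ x : K, IsIntegral ℤ x →
      ∃ a, QuarticOrder.toField (k := k) (d := d) (α - 1) hy a = m * x := by
  have hi := isIntegral_of_quartic hα
  have hadj : Algebra.adjoin ℚ {α} = ⊤ := by
    rw [← IntermediateField.adjoin_simple_toSubalgebra_of_isAlgebraic
      (Algebra.IsAlgebraic.isAlgebraic α), hK, IntermediateField.top_toSubalgebra]
  let B := PowerBasis.ofAdjoinEqTop (hi.tower_top (A := ℚ)) hadj
  have hB : B.gen = α := PowerBasis.ofAdjoinEqTop_gen _ _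
  have hBi : IsIntegral ℤ B.gen := hB ▸ hi
  obtain ⟨N, hN⟩ := IsIntegrallyClosed.isIntegral_iff.1
    (Algebra.discr_isIntegral ℚ (b := B.basis) fun i => by
      rw [B.basis_eq_pow]; exact hBi.pow _)
  have hN0 : N ≠ 0 := by
    rintro rfl
    exact Algebra.discr_not_zero_of_basis ℚ B.basis (by rw [← hN]; simp)
  set f := QuarticOrder.toField (k := k) (d := d) (α - 1) hy with hf
  have hadjle : Algebra.adjoin ℤ {α} ≤ subalgebraOfSubring f.range := by
    rw [Algebra.adjoin_le_iff, Set.singleton_subset_iff]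
    refine ⟨⟨1, 1, 0, 0⟩, ?_⟩
    rw [hf, QuarticOrder.toField_apply]
    push_cast; ring
  obtain ⟨m, hNm, hm⟩ := (Int.finiteMultiplicity_iff.2
    ⟨show (2 : ℤ).natAbs ≠ 1 by decide, hN0⟩).exists_eq_pow_mul_and_not_dvd
  refine ⟨m, Int.not_even_iff_odd.1 fun h => hm (even_iff_two_dvd.1 h), fun x hx => ?_⟩
  have h1 := Algebra.discr_mul_isIntegral_mem_adjoin ℚ hBi hx
  rw [hB] at h1
  obtain ⟨a, ha⟩ := hadjle h1
  refine QuarticOrder.exists_toField_eq_of_two_pow_mul hk _ hy (toField_injective hF hα hy)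
    (multiplicity 2 N) (a := a)
    ((isIntegral_algebraMap (R := ℤ) (x := m)).mul hx) ?_
  change f a = _ at ha
  rw [ha, ← hN, congrArg (algebraMap ℤ ℚ) hNm, Algebra.smul_def]
  simp; ring

end

/-! ### Indices of elements and of the field -/

section

variable {K : Type*} [Field K] [NumberField K]

theorem not_isMonogenicField_of_two_dvd (h : ∀ θ : 𝓞 K, 2 ∣ elementIndex θ) :
    ¬ IsMonogenicField K := by
  rintro ⟨θ, hθ⟩
  have := h θ
  rw [elementIndex, hθ] at this
  simp at this

theorem padicValNat_two_fieldIndex (h : ∀ θ : 𝓞 K, 2 ∣ elementIndex θ) (θ : 𝓞 K)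
    (hθ : IntermediateField.adjoin ℚ {(θ : K)} = ⊤) (h0 : elementIndex θ ≠ 0)
    (h4 : ¬ 4 ∣ elementIndex θ) : padicValNat 2 (fieldIndex K) = 1 := by
  set S := {d : ℕ | ∀ θ : 𝓞 K, IntermediateField.adjoin ℚ {(θ : K)} = ⊤ → d ∣ elementIndex θ}
  have hS : BddAbove S := ⟨elementIndex θ, fun d hd => Nat.le_of_dvd (Nat.pos_of_ne_zero h0) (hd θ hθ)⟩
  have hmem : sSup S ∈ S := Nat.sSup_mem ⟨1, fun _ _ => one_dvd _⟩ hS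
  have h0' : sSup S ≠ 0 := fun h' => h0 (Nat.eq_zero_of_zero_dvd (h' ▸ hmem θ hθ))
  -- S is closed under lcm with 2, so its maximum is even.
  have h2 : 2 ∣ sSup S := by
    have hle : Nat.lcm 2 (sSup S) ≤ sSup S :=
      le_csSup hS fun θ' hθ' => Nat.lcm_dvd (h θ') (hmem θ' hθ')
    have := Nat.le_antisymm hle
      (Nat.le_of_dvd (Nat.lcm_pos two_pos (Nat.pos_of_ne_zero h0')) (Nat.dvd_lcm_right _ _))
    exact this ▸ Nat.dvd_lcm_left 2 (sSup S)
  have h4' : ¬ 2 ^ 2 ∣ sSup S := fun h' => h4 (h'.trans (hmem θ hθ))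
  change padicValNat 2 (sSup S) = 1
  have h1 : 1 ≤ padicValNat 2 (sSup S) := one_le_padicValNat_of_dvd h0' h2
  rw [padicValNat_dvd_iff_le h0'] at h4'
  omega

variable {k d : ℤ} (y : K) (hy : y ^ 4 + 4 * y ^ 3 + 6 * y ^ 2 + 4 * k * y + 16 * d = 0)

/-- `QuarticOrder.toField` as a homomorphism to the ring of integers. -/
def QuarticOrder.toRingOfIntegers : QuarticOrder k d →+* 𝓞 K :=
  (toField y hy).codRestrict (integralClosure ℤ K) (isIntegral_toField y hy)

namespace QuarticOrder

theorem coe_toRingOfIntegers (a : QuarticOrder k d) :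
    (toRingOfIntegers y hy a : K) = toField y hy a := rfl

variable {y} in
theorem toRingOfIntegers_injective (hinj : Function.Injective (toField y hy)) :
    Function.Injective (toRingOfIntegers y hy) := fun a b h =>
  hinj (by rw [← coe_toRingOfIntegers, h, coe_toRingOfIntegers])

theorem two_dvd_elementIndex (hk : Odd k) (hinj : Function.Injective (toField y hy)) {m : ℤ}
    (hm : Odd m) (hmO : ∀ x : 𝓞 K, ∃ a, toRingOfIntegers y hy a = m * x) (θ : 𝓞 K) :
    2 ∣ elementIndex θ := by
  choose ψ hψ using fun i => exists_extension_zmod_two (toRingOfIntegers_injective hy hinj) hm hmO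
    (residueHoms hk i)
  refine two_dvd_index_adjoin_of_three_homs (φ := ψ) (fun i j hij => ?_) θ
  refine residueHoms_injective (d := d) hk (RingHom.ext fun a => ?_)
  rw [← hψ, ← hψ, hij]

/-- Up to odd factors, `hP` expresses Y through β modulo ℤ[γ], and `hQ` puts 2β in ℤ[γ]. Thus β
alone generates the 2-part of 𝓞 K / ℤ[γ], with order at most 2. -/
theorem elementIndex_halfSq (hk : Odd k) {m : ℤ}
    (hm : Odd m) (hmO : ∀ x : 𝓞 K, ∃ a, toRingOfIntegers y hy a = m * x) (γ : 𝓞 K)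
    (hγ : (γ : K) = y ^ 2 / 2) :
    y ∈ IntermediateField.adjoin ℚ {(γ : K)} ∧ elementIndex γ ≠ 0 ∧ ¬ 4 ∣ elementIndex γ := by
  set Y : 𝓞 K := toRingOfIntegers y hy ⟨0, 1, 0, 0⟩ with hY
  set β : 𝓞 K := toRingOfIntegers y hy ⟨0, 0, 0, 1⟩ with hβ
  have hYK : (Y : K) = y := by
    rw [hY, coe_toRingOfIntegers, toField_apply]; push_cast; ring
  have hβK : (β : K) = (y ^ 3 + 2 * y) / 4 := by
    rw [hβ, coe_toRingOfIntegers, toField_apply]; push_cast; ring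
  have hlin (a : QuarticOrder k d) :
      toRingOfIntegers y hy a = a.c0 + a.c1 * Y + a.c2 * γ + a.c3 * β := by
    apply RingOfIntegers.ext
    rw [coe_toRingOfIntegers, toField_apply]
    simp [hYK, hβK, hγ]
  -- Eliminating Y between P = (2 - k)Y - 4β and γP leaves 2uβ.
  set u : ℤ := k ^ 2 - 6 * k + 16 * d with hu
  have huodd : Odd u := by
    obtain ⟨l, rfl⟩ := hk
    exact ⟨2 * l ^ 2 - 4 * l - 3 + 8 * d, by rw [hu]; ring⟩
  have hpodd : Odd (2 - k) := by
    obtain ⟨l, rfl⟩ := hk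
    exact ⟨-l, by ring⟩
  have hP : (2 - k) * Y - 4 * β = γ ^ 2 + 3 * γ + 4 * d := by
    apply RingOfIntegers.ext
    simp only [map_add, map_mul, map_sub, map_pow, map_ofNat, map_intCast, hYK, hβK, hγ]
    linear_combination -hy / 4
  have hQ : 2 * (u * β) = (2 - k) * (γ * (γ ^ 2 + 3 * γ + 4 * d) + 32 * d + 4 * (6 - k) * γ)
      - (10 - 7 * k + 8 * d) * (γ ^ 2 + 3 * γ + 4 * d) := by
    have hYγ : Y * γ = 2 * β - Y := by
      apply RingOfIntegers.ext
      simp only [map_mul, map_sub, map_ofNat, hYK, hβK, hγ]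
      ring
    have hγβ : γ * β = 8 * d + (2 * k - 3 - 2 * d) * Y + (6 - k) * γ + 6 * β := by
      apply RingOfIntegers.ext
      simp only [map_add, map_mul, map_sub, map_ofNat, map_intCast, hYK, hβK, hγ]
      linear_combination (y / 8 - 1 / 2) * hy
    rw [← hP, hu]
    push_cast
    linear_combination -(2 - k : 𝓞 K) ^ 2 * hYγ + 4 * (2 - k : 𝓞 K) * hγβ
  refine ⟨?_, ?_⟩
  · set M := IntermediateField.adjoin ℚ {(γ : K)}
    have hγM : (γ : K) ∈ M := IntermediateField.mem_adjoin_simple_self ℚ _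
    have hcancel {n : ℤ} (hn : Odd n) {x : K} (hx : n * x ∈ M) : x ∈ M := by
      have hn0 : (n : K) ≠ 0 := by
        rw [Int.cast_ne_zero]; rintro rfl; simp at hn
      rw [← inv_mul_cancel_left₀ hn0 x]
      exact mul_mem (inv_mem (intCast_mem M n)) hx
    have hPK := congrArg (algebraMap (𝓞 K) K) hP
    have hQK := congrArg (algebraMap (𝓞 K) K) hQ
    simp only [map_add, map_mul, map_sub, map_pow, map_ofNat, map_intCast] at hPK hQK
    have hPM : (γ : K) ^ 2 + 3 * γ + 4 * d ∈ M :=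
      add_mem (add_mem (pow_mem hγM 2) (mul_mem (ofNat_mem M 3) hγM))
        (mul_mem (ofNat_mem M 4) (intCast_mem M d))
    have hβM : (β : K) ∈ M := by
      refine hcancel huodd ?_
      rw [← inv_mul_cancel_left₀ (two_ne_zero (α := K)) (u * β : K), hQK]
      refine mul_mem (inv_mem (ofNat_mem M 2)) (sub_mem (mul_mem ?_ (add_mem (add_mem
        (mul_mem hγM hPM) ?_) (mul_mem ?_ hγM))) (mul_mem ?_ hPM))
      · exact_mod_cast intCast_mem M (2 - k)
      · exact_mod_cast intCast_mem M (32 * d)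
      · exact_mod_cast intCast_mem M (4 * (6 - k))
      · exact_mod_cast intCast_mem M (10 - 7 * k + 8 * d)
    rw [← hYK]
    refine hcancel hpodd ?_
    have : ((2 - k : ℤ) : K) * Y = ((γ : K) ^ 2 + 3 * γ + 4 * d) + 4 * β := by
      push_cast; linear_combination hPK
    rw [this]
    exact add_mem hPM (mul_mem (ofNat_mem M 4) hβM)
  · set A := Algebra.adjoin ℤ {γ}
    have hγA : γ ∈ A := Algebra.self_mem_adjoin_singleton ℤ γ
    have hPA : γ ^ 2 + 3 * γ + 4 * d ∈ A :=
      add_mem (add_mem (pow_mem hγA 2) (mul_mem (ofNat_mem A 3) hγA))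
        (mul_mem (ofNat_mem A 4) (intCast_mem A d))
    refine index_ne_zero_and_not_four_dvd (Subalgebra.toSubmodule A).toAddSubgroup
      ((hpodd.mul huodd).mul hm) (t := u * β) ?_ fun x => ?_
    · change (2 : ℤ) • (u * β : 𝓞 K) ∈ A
      rw [zsmul_eq_mul, Int.cast_ofNat, hQ]
      refine sub_mem (mul_mem ?_ (add_mem (add_mem
        (mul_mem hγA hPA) ?_) (mul_mem ?_ hγA))) (mul_mem ?_ hPA)
      · exact_mod_cast intCast_mem A (2 - k)
      · exact_mod_cast intCast_mem A (32 * d)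
      · exact_mod_cast intCast_mem A (4 * (6 - k))
      · exact_mod_cast intCast_mem A (10 - 7 * k + 8 * d)
    · obtain ⟨a, ha⟩ := hmO x
      -- The coefficient of uβ after replacing (2 - k)Y by P + 4β.
      refine ⟨4 * a.c1 + (2 - k) * a.c3, ?_⟩
      have : ((2 - k) * u * m) • x - (4 * a.c1 + (2 - k) * a.c3) • (u * β : 𝓞 K) =
          (((2 - k) * u * a.c0 : ℤ) : 𝓞 K) + (((2 - k) * u * a.c2 : ℤ) : 𝓞 K) * γ
            + ((u * a.c1 : ℤ) : 𝓞 K) * (γ ^ 2 + 3 * γ + 4 * d) := by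
        rw [hlin] at ha
        rw [← hP]
        simp only [zsmul_eq_mul]
        push_cast
        linear_combination -(2 - k : 𝓞 K) * u * ha
      rw [this]
      change _ ∈ A
      exact add_mem (add_mem (intCast_mem A _) (mul_mem (intCast_mem A _) hγA))
        (mul_mem (intCast_mem A _) hPA)

end QuarticOrder

end

/-! ### Conclusion -/

theorem mainTheorem7 {K : Type*} [Field K] [NumberField K] (b c : ℤ) (α : K)
    (hF : Irreducible (X ^ 4 + C b * X + C c : ℤ[X]))
    (hα : aeval α (X ^ 4 + C b * X + C c : ℤ[X]) = 0)
    (hK : IntermediateField.adjoin ℚ {α} = ⊤)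
    (hbc : (b ≡ 0 [ZMOD 16] ∧ c ≡ -1 [ZMOD 16]) ∨ (b ≡ 8 [ZMOD 16] ∧ c ≡ 7 [ZMOD 16])) :
    padicValNat 2 (fieldIndex K) = 1 ∧ ¬ IsMonogenicField K := by
  obtain ⟨k, d, hk, hkb, hd⟩ : ∃ k d : ℤ, Odd k ∧ 4 + b = 4 * k ∧ 1 + b + c = 16 * d := by
    -- Both cases give 8 ∣ b, so k is odd, and 16 ∣ 1 + b + c.
    refine ⟨1 + b / 4, (1 + b + c) / 16, ?_, ?_, ?_⟩
    · rw [Int.odd_iff]; simp only [Int.ModEq] at hbc; omega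
    · simp only [Int.ModEq] at hbc; omega
    · simp only [Int.ModEq] at hbc; omega
  have hy := quartic_shift hα hkb hd
  have hinj := toField_injective hF hα hy
  obtain ⟨m, hm, hmK⟩ := exists_odd_mul_mem_toField hk hF hα hK hy
  have hmO (x : 𝓞 K) : ∃ a, QuarticOrder.toRingOfIntegers (α - 1) hy a = m * x := by
    obtain ⟨a, ha⟩ := hmK x x.isIntegral_coe
    exact ⟨a, RingOfIntegers.ext (by rw [QuarticOrder.coe_toRingOfIntegers, ha]; simp)⟩
  have h2 := QuarticOrder.two_dvd_elementIndex (α - 1) hy hk hinj hm hmO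
  obtain ⟨hα', h0, h4⟩ := QuarticOrder.elementIndex_halfSq (α - 1) hy hk hm hmO
    (QuarticOrder.toRingOfIntegers (α - 1) hy ⟨0, 0, 1, 0⟩)
    (by rw [QuarticOrder.coe_toRingOfIntegers, QuarticOrder.toField_apply]; push_cast; ring)
  refine ⟨padicValNat_two_fieldIndex h2 _ ?_ h0 h4, not_isMonogenicField_of_two_dvd h2⟩
  rw [eq_top_iff, ← hK, IntermediateField.adjoin_simple_le_iff]
  simpa using add_mem hα' (one_mem _)
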